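/- Let $K$ be a finite simplicial complex with vertex set $V(K)$ and let $g\colon V(K)\to\mathbb R$ be any function. For $\alpha\in\mathbb R$ let $K_\alpha$ be the subcomplex of simplices all of whose vertices $u$ satisfy $g(u)\le\alpha$, and let $\mathrm{st}^{\downarrow}(v,K)$, the descending open star of a vertex $v$, be the set of simplices of $K_{g(v)}$ that contain $v$. A vertex $v$ is *dominated* by $a$ in a complex if its link there is a simplicial cone with apex $a$ (over a possibly empty base). The vertex $v$ is *descending dominated* if it is dominated in $K_{g(v)}$ by a vertex $a$ with $g(a)<g(v)$, and *strong critical* otherwise. Let $C$ be the union of the sets $\mathrm{st}^{\downarrow}(w,K)$ over all strong critical vertices $w$. Choose for every descending dominated vertex $v$ a vertex $a_v$ with $g(a_v)<g(v)$ that dominates $v$ in $K_{g(v)}$, and choose a total order on $V(K)$ along which $g$ is non-decreasing. For a simplex $\sigma\notin C$ let $v_\sigma$ be its last vertex in this order (it maximizes $g$ on $\sigma$ and is descending dominated), and put $a_\sigma=a_{v_\sigma}$. *The core $\mathrm{core}_g(K)$ (for the chosen vertices $a_v$).* Let $t_0<t_1<\dots<t_{m-1}$ be the values of $g$, let $K^{(n)}$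 be the full subcomplex of $K$ on the vertices with $g<t_n$ (and $K^{(m)}=K$), and let $D^{(n)}$ be the full subcomplex on these vertices together with the descending dominated vertices $v$ with $g(v)=t_n$. The vertex map that sends each such $v$ to $a_v$ and fixes the other vertices induces the retraction $r_n\colon|D^{(n)}|\to|K^{(n)}|$ of the strong collapse removing these $v$. Put $X_0=|K^{(0)}|=\varnothing$ and $R_0=\mathrm{id}$, let $X_{n+1}$ be the pushout of $|K^{(n+1)}|\hookleftarrow|D^{(n)}|\xrightarrow{R_n\circ r_n}X_n$, and let $R_{n+1}\colon|K^{(n+1)}|\to X_{n+1}$ be the canonical map. Then $\mathrm{core}_g(K)=X_m$; its open cells are the images under $R_m$ of the open simplices in $C$. *Discrete Morse functions and their cores.* Write $\tau\prec\sigma$ if $\tau$ is a face of $\sigma$ and $\dim\sigma=\dim\tau+1$. A function $f$ from the simplices of $K$ to $\mathbb R$ is a *discrete Morse function* if for every $\sigma$ the set $M(\sigma)=\{\tau\prec\sigma: f(\tau)\ge f(\sigma)\}\cup\{\tau\succ\sigma: f(\tau)\le f(\sigma)\}$ has at most one element; $\sigma$ is *critical* if $M(\sigma)=\varnothing$, and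 the *matching of $f$* consists of the pairs $\sigma\prec\tau$ with $M(\sigma)=\{\tau\}$. Let $K^f_\alpha$ be the smallest subcomplex of $K$ containing all $\sigma$ with $f(\sigma)\le\alpha$. An *internal core* $\mathrm{core}_f(K)$ is a space $X$, with a map $R\colon|K|\to X$, obtained along a finite increasing sequence of sublevel complexes from $\varnothing$ to $K$ by steps $K^f_\alpha\subseteq K^f_\beta$ of two kinds: (i) if there is no critical simplex in $f^{-1}((\alpha,\beta])$ and $K^f_\beta$ collapses to $K^f_\alpha$, keep $X$ and precompose $R$ with a strong deformation retraction $|K^f_\beta|\to|K^f_\alpha|$; (ii) if $K^f_\beta=K^f_\alpha\cup\{\sigma\}$ with $\sigma\notin K^f_\alpha$ critical, replace $X$ by the pushout of $|K^f_\beta|\hookleftarrow|K^f_\alpha|\xrightarrow{R}X$ and $R$ by the canonical map. Its open cells are the images of the open critical simplices. **Theorem (Connection to discrete Morse theory).** For every $K$, $g$ and all choices as above: 1. The pairs $(\sigma\setminus\{a_\sigma\},\ \sigma\cup\{a_\sigma\})$, $\sigma\notin C$, form an acyclic matching $M$ on the face poset of $K$: they are disjoint pairs of consecutive-dimensional simplices,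 and the preorder induced on the quotient of the face poset identifying the two members of each pair is antisymmetric. 2. There is a discrete Morse function $f$ on $K$ whose critical simplices are exactly the simplices in $C$, whose matching is $M$, and such that $\mathrm{core}_g(K)\cong\mathrm{core}_f(K)$ for some internal core $\mathrm{core}_f(K)$ of $f$, by a homeomorphism that maps the open cell of each $\sigma\in C$ onto the open cell of $\sigma$. -/

import Mathlib

namespace StrongMorse

open Finset

universe u

section Simplicial

variable {V : Type u} [DecidableEq V]

/-- The simplices of `L` all of whose vertices lie in `S` (the full subcomplex spanned by `S`). -/
def full (L : PreAbstractSimplicialComplex V) (S : Set V) : PreAbstractSimplicialComplex V where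
  faces := {σ | σ ∈ L.faces ∧ ∀ u ∈ σ, u ∈ S}
  isRelLowerSet_faces := fun _ h =>
    ⟨(L.isRelLowerSet_faces h.1).1, fun _ hts ht =>
      ⟨(L.isRelLowerSet_faces h.1).2 hts ht, fun u hu => h.2 u (hts hu)⟩⟩

/-- The open star of `v` in `L`: the simplices of `L` that contain `v`. -/
def openStar (L : PreAbstractSimplicialComplex V) (v : V) : Set (Finset V) :=
  {σ | σ ∈ L.faces ∧ v ∈ σ}

/-- The link of `v` in `L`. -/
def link (L : PreAbstractSimplicialComplex V) (v : V) : PreAbstractSimplicialComplex V where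
  faces := {σ | σ ∈ L.faces ∧ v ∉ σ ∧ insert v σ ∈ L.faces}
  isRelLowerSet_faces := fun _ h =>
    ⟨(L.isRelLowerSet_faces h.1).1, fun _ hts ht =>
      ⟨(L.isRelLowerSet_faces h.1).2 hts ht, fun hv => h.2.1 (hts hv),
        (L.isRelLowerSet_faces h.2.2).2 (Finset.insert_subset_insert v hts)
          (Finset.insert_nonempty _ _)⟩⟩

/-- `L` is a simplicial cone `a * L₀` over a (possibly empty) complex `L₀` of which `a` is not a
vertex: its simplices are those of `L₀`, the vertex `{a}`, and all `σ ∪ {a}` with `σ ∈ L₀`. -/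
def IsConeWithApex (L : PreAbstractSimplicialComplex V) (a : V) : Prop :=
  ∃ L₀ : PreAbstractSimplicialComplex V, (∀ σ ∈ L₀.faces, a ∉ σ) ∧
    L.faces = L₀.faces ∪ {{a}} ∪ {τ | ∃ σ ∈ L₀.faces, τ = insert a σ}

/-- The vertex `v` is dominated by `a` in `L`. -/
def Dominates (L : PreAbstractSimplicialComplex V) (a v : V) : Prop :=
  IsConeWithApex (link L v) a

theorem Dominates.insert_mem {L : PreAbstractSimplicialComplex V} {a v : V} (h : Dominates L a v)
    {σ : Finset V} (hσ : σ ∈ L.faces) (hv : v ∈ σ) : insert a σ ∈ L.faces := by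
  obtain ⟨L₀, _, hL⟩ := h
  have key : ∀ τ ∈ (link L v).faces, insert a τ ∈ (link L v).faces := by
    intro τ hτ
    rw [hL] at hτ ⊢
    rcases hτ with (hτ | hτ) | ⟨ρ, hρ, rfl⟩
    · exact Or.inr ⟨τ, hτ, rfl⟩
    · have : τ = {a} := hτ
      subst this
      exact Or.inl (Or.inr (by simp))
    · exact Or.inr ⟨ρ, hρ, by simp⟩
  have ha : ({a} : Finset V) ∈ (link L v).faces := by
    rw [hL]; exact Or.inl (Or.inr rfl)
  by_cases hne : (σ.erase v).Nonempty
  · have h1 : σ.erase v ∈ (link L v).faces := by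
      refine ⟨(L.isRelLowerSet_faces hσ).2 (Finset.erase_subset _ _) hne, by simp, ?_⟩
      rwa [Finset.insert_erase hv]
    have h2 := (key _ h1).2.2
    rwa [Finset.insert_comm, Finset.insert_erase hv] at h2
  · have h1 : σ = {v} := by
      rw [Finset.not_nonempty_iff_eq_empty] at hne
      rw [← Finset.insert_erase hv, hne]
      rfl
    subst h1
    have h2 := ha.2.2
    rwa [Finset.pair_comm] at h2

/-- There is an elementary collapse from `L` to `L'`: removal of a free face `σ` and of the unique
simplex `τ` that properly contains it. -/
def ElementaryCollapse (L L' : PreAbstractSimplicialComplex V) : Prop :=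
  ∃ σ ∈ L.faces, ∃ τ ∈ L.faces, σ ⊂ τ ∧ (∀ ρ ∈ L.faces, σ ⊂ ρ → ρ = τ) ∧
    L'.faces = L.faces \ {σ, τ}

/-- `L` collapses to `L'`. -/
def Collapses : PreAbstractSimplicialComplex V → PreAbstractSimplicialComplex V → Prop :=
  Relation.ReflTransGen ElementaryCollapse

end Simplicial

section Realization

variable {V : Type u} [DecidableEq V] [Fintype V]

/-- The vertices with non-zero barycentric coordinate. -/
noncomputable def carrier (x : V → ℝ) : Finset V := {v | x v ≠ 0}

/-- The geometric realization `|L|`, in barycentric coordinates, with the topology induced from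
`V → ℝ` (the vertex set is finite). -/
def realization (L : PreAbstractSimplicialComplex V) : Set (V → ℝ) :=
  {x | (∀ v, 0 ≤ x v) ∧ ∑ v, x v = 1 ∧ carrier x ∈ L.faces}

theorem realization_mono {L L' : PreAbstractSimplicialComplex V} (h : L.faces ⊆ L'.faces) :
    realization L ⊆ realization L' :=
  fun _ hx => ⟨hx.1, hx.2.1, h hx.2.2⟩

/-- The inclusion `|L| → |L'|` of a subcomplex. -/
def realizationIncl {L L' : PreAbstractSimplicialComplex V} (h : L.faces ⊆ L'.faces) :
    C(realization L, realization L') :=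
  ContinuousMap.inclusion (realization_mono h)

theorem pushforward_mem {L L' : PreAbstractSimplicialComplex V} (φ : V → V)
    (h : ∀ σ ∈ L.faces, σ.image φ ∈ L'.faces) {x : V → ℝ} (hx : x ∈ realization L) :
    (fun u => ∑ v with φ v = u, x v) ∈ realization L' := by
  obtain ⟨h0, h1, h2⟩ := hx
  refine ⟨fun u => Finset.sum_nonneg fun v _ => h0 v, ?_, ?_⟩
  · rw [← h1]
    exact Finset.sum_fiberwise Finset.univ φ x
  · convert h _ h2 using 1
    ext u
    simp only [carrier, Finset.mem_filter, Finset.mem_univ, true_and, Finset.mem_image, ne_eq]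
    rw [Finset.sum_eq_zero_iff_of_nonneg fun v _ => h0 v]
    simp only [Finset.mem_filter, Finset.mem_univ, true_and]
    push Not
    exact ⟨fun ⟨v, hv, hx⟩ => ⟨v, hx, hv⟩, fun ⟨v, hx, hv⟩ => ⟨v, hv, hx⟩⟩

/-- The geometric realization `|φ| : |L| → |L'|` of a simplicial map `φ`. -/
noncomputable def realizationMap {L L' : PreAbstractSimplicialComplex V} (φ : V → V)
    (h : ∀ σ ∈ L.faces, σ.image φ ∈ L'.faces) : C(realization L, realization L') where
  toFun x := ⟨fun u => ∑ v with φ v = u, x.1 v, pushforward_mem φ h x.2⟩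
  continuous_toFun := by fun_prop

/-- `ρ` is a strong deformation retraction of `|L'|` onto `|L|`: followed by the inclusion it is
homotopic to the identity, through a homotopy that is stationary on `|L|`. -/
def IsStrongDeformationRetraction {L L' : PreAbstractSimplicialComplex V}
    (h : L.faces ⊆ L'.faces) (ρ : C(realization L', realization L)) : Prop :=
  ContinuousMap.HomotopicRel (ContinuousMap.id (realization L')) ((realizationIncl h).comp ρ)
    (Set.range (realizationIncl h))

end Realization

section Adjunction

variable {A B X : Type u} [TopologicalSpace A] [TopologicalSpace B] [TopologicalSpace X]

/-- `i a ∼ φ a` for `a ∈ A`. -/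
inductive GlueRel (i : C(A, B)) (φ : C(A, X)) : X ⊕ B → X ⊕ B → Prop
  | glue (a : A) : GlueRel i φ (Sum.inr (i a)) (Sum.inl (φ a))

/-- The adjunction space (pushout) `X ∪_φ B` of `B ←i— A —φ→ X`, with the quotient topology. -/
def Glue (i : C(A, B)) (φ : C(A, X)) : Type u := Quot (GlueRel i φ)

instance (i : C(A, B)) (φ : C(A, X)) : TopologicalSpace (Glue i φ) :=
  inferInstanceAs (TopologicalSpace (Quot (GlueRel i φ)))

/-- The canonical map `B → X ∪_φ B`. -/
def Glue.inr (i : C(A, B)) (φ : C(A, X)) : C(B, Glue i φ) where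
  toFun b := Quot.mk _ (Sum.inr b)
  continuous_toFun := continuous_quot_mk.comp continuous_inr

end Adjunction

section VertexFunction

variable {V : Type u} [DecidableEq V]

/-- The sublevel complex `K_α`, spanned by the vertices `u` with `g u ≤ α`. -/
def vertexSublevel (K : AbstractSimplicialComplex V) (g : V → ℝ) (α : ℝ) :
    PreAbstractSimplicialComplex V :=
  full K.toPreAbstractSimplicialComplex {u | g u ≤ α}

/-- The descending open star of `v`. -/
def descendingOpenStar (K : AbstractSimplicialComplex V) (g : V → ℝ) (v : V) : Set (Finset V) :=
  openStar (vertexSublevel K g (g v)) v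

/-- `v` is descending dominated: dominated in `K_{g(v)}` by a vertex `a` with `g a < g v`. -/
def DescendingDominated (K : AbstractSimplicialComplex V) (g : V → ℝ) (v : V) : Prop :=
  ∃ a, g a < g v ∧ Dominates (vertexSublevel K g (g v)) a v

/-- `v` is a strong critical vertex. -/
def StrongCritical (K : AbstractSimplicialComplex V) (g : V → ℝ) (v : V) : Prop :=
  ¬ DescendingDominated K g v

/-- The simplices in the descending open stars of the strong critical vertices of `g`. -/
def strongCriticalSimplices (K : AbstractSimplicialComplex V) (g : V → ℝ) :
    Set (Finset V) :=
  {σ | ∃ w, StrongCritical K g w ∧ σ ∈ descendingOpenStar K g w}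

/-- A choice, for each descending dominated vertex `v`, of a vertex `a v` with `g (a v) < g v` that
dominates `v` in `K_{g(v)}` (the values of `a` at strong critical vertices are irrelevant). -/
structure DominatingChoice (K : AbstractSimplicialComplex V) (g : V → ℝ) where
  a : V → V
  lt : ∀ v, DescendingDominated K g v → g (a v) < g v
  dominates : ∀ v, DescendingDominated K g v → Dominates (vertexSublevel K g (g v)) (a v) v

variable [Fintype V]

/-- The number of values of `g` below `g v`: the vertices with `level g v = n` are those on which
`g` takes its `n`-th smallest value (counting from `0`). -/
noncomputable def level (g : V → ℝ) (v : V) : ℕ := #{t ∈ univ.image g | t < g v}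

/-- The number of values of `g`. -/
noncomputable def numLevels (g : V → ℝ) : ℕ := #(univ.image g)

theorem level_lt_iff (g : V → ℝ) (u v : V) : level g u < level g v ↔ g u < g v := by
  constructor
  · intro h
    by_contra! hle
    refine absurd h (not_lt.mpr (Finset.card_le_card fun t ht => ?_))
    simp only [Finset.mem_filter] at ht ⊢
    exact ⟨ht.1, ht.2.trans_le hle⟩
  · intro h
    refine Finset.card_lt_card ((Finset.ssubset_iff_of_subset fun t ht => ?_).mpr ⟨g u, ?_, ?_⟩)
    · simp only [Finset.mem_filter] at ht ⊢
      exact ⟨ht.1, ht.2.trans h⟩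
    · simp [h]
    · simp

/-- The subcomplex spanned by the vertices on the `n` lowest levels. -/
noncomputable def below (K : AbstractSimplicialComplex V) (g : V → ℝ) (n : ℕ) :
    PreAbstractSimplicialComplex V :=
  full K.toPreAbstractSimplicialComplex {u | level g u < n}

/-- The subcomplex spanned by the vertices on the `n` lowest levels together with the descending
dominated vertices on the next level. -/
noncomputable def belowDominated (K : AbstractSimplicialComplex V) (g : V → ℝ) (n : ℕ) :
    PreAbstractSimplicialComplex V :=
  full K.toPreAbstractSimplicialComplex
    {u | level g u < n ∨ (level g u = n ∧ DescendingDominated K g u)}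

theorem belowDominated_subset (K : AbstractSimplicialComplex V) (g : V → ℝ) (n : ℕ) :
    (belowDominated K g n).faces ⊆ (below K g (n + 1)).faces := by
  rintro σ ⟨h1, h2⟩
  refine ⟨h1, fun u hu => ?_⟩
  have := h2 u hu
  simp only [Set.mem_ofPred_eq] at this ⊢
  omega

open Classical in
/-- The vertex map that sends each descending dominated vertex `v` on level `n` to the vertex `a v`
dominating it and fixes all other vertices: the composite, in any order, of the retractions
`r_{a v}` of the elementary strong collapses that remove these vertices. -/
noncomputable def retractVertex {K : AbstractSimplicialComplex V} {g : V → ℝ}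
    (c : DominatingChoice K g) (n : ℕ) (v : V) : V :=
  if level g v = n ∧ DescendingDominated K g v then c.a v else v

theorem retractVertex_simplicial {K : AbstractSimplicialComplex V} {g : V → ℝ}
    (c : DominatingChoice K g) (n : ℕ) :
    ∀ σ ∈ (belowDominated K g n).faces, σ.image (retractVertex c n) ∈ (below K g n).faces := by
  rintro σ ⟨hσ, hlev⟩
  simp only [Set.mem_ofPred_eq] at hlev
  have hsub : ∀ u ∈ σ, ∀ v ∈ σ, level g v = n → g u ≤ g v := by
    intro u hu v hv hvn
    by_contra! hlt
    have h1 := (level_lt_iff g v u).mpr hlt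
    have h2 := hlev u hu
    omega
  -- adding the dominating vertices one at a time
  have key : ∀ T : Finset V, (∀ v ∈ T, v ∈ σ ∧ level g v = n ∧ DescendingDominated K g v) →
      σ ∪ T.image c.a ∈ K.faces := by
    intro T
    induction T using Finset.induction_on with
    | empty => intro _; simpa using hσ
    | insert v T _ ih =>
      intro hT
      have ih' := ih fun u hu => hT u (Finset.mem_insert_of_mem hu)
      obtain ⟨hv, hvn, hvd⟩ := hT v (Finset.mem_insert_self _ _)
      have hmem : σ ∪ T.image c.a ∈ (vertexSublevel K g (g v)).faces := by
        refine ⟨ih', fun u hu => ?_⟩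
        rcases Finset.mem_union.mp hu with hu | hu
        · exact hsub u hu v hv hvn
        · obtain ⟨w, hw, rfl⟩ := Finset.mem_image.mp hu
          obtain ⟨hwσ, _, hwd⟩ := hT w (Finset.mem_insert_of_mem hw)
          exact (c.lt w hwd).le.trans (hsub w hwσ v hv hvn)
      have h := ((c.dominates v hvd).insert_mem hmem (Finset.mem_union_left _ hv)).1
      rwa [Finset.image_insert, Finset.union_insert]
  classical
  have hne : σ.Nonempty := (K.isRelLowerSet_faces hσ).1
  constructor
  · have hT := key {v ∈ σ | level g v = n ∧ DescendingDominated K g v} (by simp)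
    refine (K.isRelLowerSet_faces hT).2 (fun u hu => ?_) (hne.image _)
    obtain ⟨v, hv, rfl⟩ := Finset.mem_image.mp hu
    unfold retractVertex
    split_ifs with h
    · exact Finset.mem_union_right _ (Finset.mem_image_of_mem _ (by simp [hv, h]))
    · exact Finset.mem_union_left _ hv
  · intro u hu
    obtain ⟨v, hv, rfl⟩ := Finset.mem_image.mp hu
    have hlv := hlev v hv
    simp only [Set.mem_ofPred_eq]
    unfold retractVertex
    split_ifs with h
    · exact ((level_lt_iff g _ _).mpr (c.lt v h.2)).trans_eq h.1
    · tauto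

/-- The strong deformation retraction `|r|` of the strong collapse that removes the descending
dominated vertices on level `n`. -/
noncomputable def strongRetraction {K : AbstractSimplicialComplex V} {g : V → ℝ}
    (c : DominatingChoice K g) (n : ℕ) :
    C(realization (belowDominated K g n), realization (below K g n)) :=
  realizationMap (retractVertex c n) (retractVertex_simplicial c n)

/-- The reduced complex after the `n` lowest levels, with the map to it from the realization of the
subcomplex spanned by these levels. On the next level, first the descending dominated vertices are
removed by a strong collapse; then the simplices in the descending open stars of the strong
critical vertices are attached, along their original attaching maps followed by the retraction of
the strong collapse and by the map to the complex reduced so far. -/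
noncomputable def strongCoreStage {K : AbstractSimplicialComplex V} {g : V → ℝ}
    (c : DominatingChoice K g) :
    (n : ℕ) → Σ X : TopCat.{u}, C(realization (below K g n), X)
  | 0 => ⟨TopCat.of (realization (below K g 0)), ContinuousMap.id _⟩
  | n + 1 =>
    let i := realizationIncl (belowDominated_subset K g n)
    let φ := (strongCoreStage c n).2.comp (strongRetraction c n)
    ⟨TopCat.of (Glue i φ), Glue.inr i φ⟩

/-- The strong internal core `core_g(K)`, for the given choice of dominating vertices. -/
noncomputable def strongCore {K : AbstractSimplicialComplex V} {g : V → ℝ}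
    (c : DominatingChoice K g) : TopCat.{u} :=
  (strongCoreStage c (numLevels g)).1

/-- The canonical map `|K| → core_g(K)` (all vertices of `K` lie on the first `numLevels g`
levels). -/
noncomputable def strongCoreMap {K : AbstractSimplicialComplex V} {g : V → ℝ}
    (c : DominatingChoice K g) : C(realization (below K g (numLevels g)), strongCore c) :=
  (strongCoreStage c (numLevels g)).2

/-- The image in `X` of the open simplex `σ` of `L`. For a critical simplex `σ` and the canonical
map from `|K|` to a core this is the open cell of the core that corresponds to `σ`. -/
def openCell {L : PreAbstractSimplicialComplex V} {X : TopCat.{u}} (R : C(realization L, X))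
    (σ : Finset V) : Set X :=
  R '' {x | carrier x.1 = σ}

end VertexFunction

section DiscreteMorse

variable {V : Type u} [DecidableEq V]

/-- The face poset of `K` (simplices ordered by inclusion). -/
abbrev Simplex (K : AbstractSimplicialComplex V) : Type u := {σ : Finset V // σ ∈ K.faces}

/-- `σ ≺ τ`: `σ` is a face of `τ` and `dim τ = dim σ + 1`. -/
def IsFacet {K : AbstractSimplicialComplex V} (σ τ : Simplex K) : Prop :=
  σ.1 ⊆ τ.1 ∧ #τ.1 = #σ.1 + 1

/-- The set `M(σ)`. -/
def morseSet {K : AbstractSimplicialComplex V} (f : Simplex K → ℝ) (σ : Simplex K) :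
    Set (Simplex K) :=
  {τ | IsFacet τ σ ∧ f τ ≥ f σ} ∪ {τ | IsFacet σ τ ∧ f τ ≤ f σ}

/-- `f` is a discrete Morse function: every `M(σ)` has at most one element. -/
def IsDiscreteMorse {K : AbstractSimplicialComplex V} (f : Simplex K → ℝ) : Prop :=
  ∀ σ, (morseSet f σ).Subsingleton

/-- `σ` is a critical simplex of `f`. -/
def IsCritical {K : AbstractSimplicialComplex V} (f : Simplex K → ℝ) (σ : Simplex K) : Prop :=
  morseSet f σ = ∅

/-- The matching of `f`: the pairs `σ ≺ τ` with `M(σ) = {τ}`. -/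
def morseMatching {K : AbstractSimplicialComplex V} (f : Simplex K → ℝ) :
    Set (Simplex K × Simplex K) :=
  {p | IsFacet p.1 p.2 ∧ morseSet f p.1 = {p.2}}

/-- `M` is an acyclic matching on the poset `X`: its members are pairwise disjoint pairs `x ⋖ y`,
and the preorder generated by `≤` on the quotient of `X` in which the two members of each pair are
identified is antisymmetric. -/
structure IsAcyclicMatching {X : Type u} [PartialOrder X] (M : Set (X × X)) : Prop where
  covBy : ∀ p ∈ M, p.1 ⋖ p.2
  disjoint : ∀ p ∈ M, ∀ q ∈ M, p ≠ q → p.1 ≠ q.1 ∧ p.1 ≠ q.2 ∧ p.2 ≠ q.1 ∧ p.2 ≠ q.2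
  antisymm : ∀ x y : X,
    Relation.TransGen (fun x y => x ≤ y ∨ (x, y) ∈ M ∨ (y, x) ∈ M) x y →
    Relation.TransGen (fun x y => x ≤ y ∨ (x, y) ∈ M ∨ (y, x) ∈ M) y x →
    x = y ∨ (x, y) ∈ M ∨ (y, x) ∈ M

/-- The last vertex of a simplex in a given total order of the vertices. -/
def lastVertex (lo : LinearOrder V) {K : AbstractSimplicialComplex V} (σ : Simplex K) : V :=
  @Finset.max' V lo σ.1 (K.isRelLowerSet_faces σ.2).1

/-- The explicit matching: a simplex `σ` that is in no descending open star of a strong critical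
vertex gives the pair `(σ \ {a_σ}, σ ∪ {a_σ})`, where `a_σ` is the vertex chosen to dominate the last
vertex `v_σ` of `σ`. -/
def strongMatching {K : AbstractSimplicialComplex V} {g : V → ℝ} (c : DominatingChoice K g)
    (lo : LinearOrder V) : Set (Simplex K × Simplex K) :=
  {p | ∃ σ : Simplex K, σ.1 ∉ strongCriticalSimplices K g ∧
    p.1.1 = σ.1.erase (c.a (lastVertex lo σ)) ∧ p.2.1 = insert (c.a (lastVertex lo σ)) σ.1}

/-- The sublevel complex `K_α` of `f`: the smallest subcomplex that contains all simplices `σ` with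
`f σ ≤ α`. -/
def simplexSublevel {K : AbstractSimplicialComplex V} (f : Simplex K → ℝ) (α : ℝ) :
    PreAbstractSimplicialComplex V where
  faces := {τ | τ.Nonempty ∧ ∃ σ : Simplex K, τ ⊆ σ.1 ∧ f σ ≤ α}
  isRelLowerSet_faces := fun _ h =>
    ⟨h.1, fun _ hts ht => ⟨ht, h.2.imp fun _ hσ => ⟨hts.trans hσ.1, hσ.2⟩⟩⟩

theorem simplexSublevel_mono {K : AbstractSimplicialComplex V} (f : Simplex K → ℝ) {α β : ℝ}
    (h : α ≤ β) : (simplexSublevel f α).faces ⊆ (simplexSublevel f β).faces :=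
  fun _ hτ => ⟨hτ.1, hτ.2.imp fun _ hσ => ⟨hσ.1, hσ.2.trans h⟩⟩

variable [Fintype V]

/-- `InternalCoreStage f α X R`: the space `X`, with the map `R : |K_α| → X`, is obtained by
following the filtration of `K` by the sublevel complexes of `f` up to `α`.
* While the sublevel complex is empty, so is `X`.
* If there are no critical simplices in `f⁻¹((α, β])` and `K_β` collapses to `K_α`, then an internal
  collapse is made: `X` stays, and `R` is precomposed with a strong deformation retraction of
  `|K_β|` onto `|K_α|`.
* If `K_β = K_α ∪ {σ}` with `σ` critical, then a cell is attached to `X`, along the attaching map of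
  `σ` followed by `R`. -/
inductive InternalCoreStage {K : AbstractSimplicialComplex V} (f : Simplex K → ℝ) :
    (α : ℝ) → (X : TopCat.{u}) → C(realization (simplexSublevel f α), X) → Prop
  | start (α : ℝ) (hα : ∀ σ, α < f σ) :
      InternalCoreStage f α (TopCat.of (realization (simplexSublevel f α))) (ContinuousMap.id _)
  | collapse {α β : ℝ} (hαβ : α ≤ β) {X : TopCat.{u}}
      {R : C(realization (simplexSublevel f α), X)} (hR : InternalCoreStage f α X R)
      (hcrit : ∀ σ, IsCritical f σ → ¬ (α < f σ ∧ f σ ≤ β))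
      (hcoll : Collapses (simplexSublevel f β) (simplexSublevel f α))
      (ρ : C(realization (simplexSublevel f β), realization (simplexSublevel f α)))
      (hρ : IsStrongDeformationRetraction (simplexSublevel_mono f hαβ) ρ) :
      InternalCoreStage f β X (R.comp ρ)
  | attach {α β : ℝ} (hαβ : α ≤ β) {X : TopCat.{u}}
      {R : C(realization (simplexSublevel f α), X)} (hR : InternalCoreStage f α X R)
      (σ : Simplex K) (hσ : IsCritical f σ) (hσα : σ.1 ∉ (simplexSublevel f α).faces)
      (hβ : (simplexSublevel f β).faces = insert σ.1 (simplexSublevel f α).faces) :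
      InternalCoreStage f β (TopCat.of (Glue (realizationIncl (simplexSublevel_mono f hαβ)) R))
        (Glue.inr (realizationIncl (simplexSublevel_mono f hαβ)) R)

end DiscreteMorse

end StrongMorse

/-!
Let `C` be the set of simplices in the descending open stars of the strong critical vertices. For
`σ ∉ C`, adding or removing the vertex `a_σ` changes neither the last vertex of `σ` nor its vertices
on the highest level, because `a_σ` lies on a lower level. So the pairs of the matching are disjoint
and cover exactly the simplices outside `C`.

Acyclicity and the discrete Morse function come from a single rank on the simplices. Its key is the
lexicographic pair of `stageIndex`, which records the highest level of a simplex and whether the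
simplex is collapsed or attached on that level, and of the larger member of its pair, in the
colexicographic order. The key is monotone along faces, and two simplices have the same key only if
they are equal or paired (`exists_strongMatching_rank`). A natural-number rank with these two
properties (`IsMatchingRank`) is a discrete Morse function with the given matching, and its
monotonicity excludes cycles. Its sublevel sets are subcomplexes, among them all complexes
`below K g n` and `belowDominated K g n`.

For the cores, the internal collapse from `belowDominated K g n` to `below K g n` may use any strong
deformation retraction. The retraction of the strong collapse is one, as it is contiguous to the
identity (`isStrongDeformationRetraction_strongRetraction`), and the elementary collapses are read
off the rank, one pair at a time (`IsMatchingRank.collapses`). After that the strong core attaches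
all critical simplices of the level at once, while the internal core attaches them one at a time.
Both give the same space by the pasting law for pushouts (`IsMatchingRank.isStageModel_glue`).
-/

namespace StrongMorse

open Finset CategoryTheory Limits

universe u

/-! ### Ranks of matchings -/

section MatchingRank

variable {V : Type u} {K : AbstractSimplicialComplex V}
  {M : Set (Simplex K × Simplex K)} {f : Simplex K → ℕ}

/-- `f` is monotone along faces and its fibres are exactly the pairs of the matching `M` and the
unmatched simplices. Such an `f` is a linear extension of the quotient of the face poset in which
the members of each pair are identified. -/
structure IsMatchingRank (M : Set (Simplex K × Simplex K)) (f : Simplex K → ℕ) : Prop where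
  facet : ∀ p ∈ M, IsFacet p.1 p.2
  mono : ∀ σ τ : Simplex K, σ.1 ⊆ τ.1 → f σ ≤ f τ
  eq_iff : ∀ σ τ : Simplex K, f σ = f τ ↔ σ = τ ∨ (σ, τ) ∈ M ∨ (τ, σ) ∈ M

namespace IsMatchingRank

theorem mem_morseSet (hf : IsMatchingRank M f) {σ τ : Simplex K} :
    τ ∈ morseSet (fun ρ => (f ρ : ℝ)) σ ↔ (τ, σ) ∈ M ∨ (σ, τ) ∈ M := by
  simp only [morseSet, Set.mem_union, Set.mem_ofPred_eq, ge_iff_le, Nat.cast_le]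
  constructor
  · rintro (⟨h, hle⟩ | ⟨h, hle⟩)
    · rcases (hf.eq_iff τ σ).mp (le_antisymm (hf.mono _ _ h.1) hle) with rfl | h' | h'
      · have := h.2; omega
      · exact Or.inl h'
      · exact Or.inr h'
    · rcases (hf.eq_iff τ σ).mp (le_antisymm hle (hf.mono _ _ h.1)) with rfl | h' | h'
      · have := h.2; omega
      · exact Or.inl h'
      · exact Or.inr h'
  · rintro (h | h)
    · exact Or.inl ⟨hf.facet _ h, ((hf.eq_iff τ σ).mpr (Or.inr (Or.inl h))).ge⟩
    · exact Or.inr ⟨hf.facet _ h, ((hf.eq_iff τ σ).mpr (Or.inr (Or.inr h))).le⟩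

theorem morseSet_subsingleton (hf : IsMatchingRank M f) (σ : Simplex K) :
    (morseSet (fun ρ => (f ρ : ℝ)) σ).Subsingleton := by
  intro τ hτ ρ hρ
  rw [hf.mem_morseSet] at hτ hρ
  have key : ∀ τ : Simplex K, (τ, σ) ∈ M ∨ (σ, τ) ∈ M →
      f τ = f σ ∧ (#σ.1 = #τ.1 + 1 ∨ #τ.1 = #σ.1 + 1) := by
    rintro τ (h | h)
    · exact ⟨(hf.eq_iff τ σ).mpr (Or.inr (Or.inl h)), Or.inl (hf.facet _ h).2⟩
    · exact ⟨(hf.eq_iff τ σ).mpr (Or.inr (Or.inr h)), Or.inr (hf.facet _ h).2⟩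
  obtain ⟨h1, h2⟩ := key τ hτ
  obtain ⟨h3, h4⟩ := key ρ hρ
  -- the numbers of vertices of `τ` and `ρ` have the same parity
  rcases (hf.eq_iff τ ρ).mp (h1.trans h3.symm) with h | h | h
  · exact h
  · have : #ρ.1 = #τ.1 + 1 := (hf.facet _ h).2
    omega
  · have : #τ.1 = #ρ.1 + 1 := (hf.facet _ h).2
    omega

theorem isDiscreteMorse (hf : IsMatchingRank M f) :
    IsDiscreteMorse (fun ρ : Simplex K => (f ρ : ℝ)) :=
  hf.morseSet_subsingleton

theorem isCritical_iff (hf : IsMatchingRank M f) (σ : Simplex K) :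
    IsCritical (fun ρ => (f ρ : ℝ)) σ ↔ ∀ τ, (τ, σ) ∉ M ∧ (σ, τ) ∉ M := by
  simp only [IsCritical, Set.eq_empty_iff_forall_notMem, hf.mem_morseSet, not_or]

theorem morseMatching_eq (hf : IsMatchingRank M f) :
    morseMatching (fun ρ => (f ρ : ℝ)) = M := by
  ext ⟨σ, τ⟩
  constructor
  · rintro ⟨h, hM⟩
    have hτ : τ ∈ morseSet (fun ρ => (f ρ : ℝ)) σ := hM ▸ rfl
    rcases hf.mem_morseSet.mp hτ with h' | h'
    · have h1 : #σ.1 = #τ.1 + 1 := (hf.facet _ h').2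
      have h2 : #τ.1 = #σ.1 + 1 := h.2
      omega
    · exact h'
  · intro h
    exact ⟨hf.facet _ h, (hf.morseSet_subsingleton σ).eq_singleton_of_mem
      (hf.mem_morseSet.mpr (Or.inr h))⟩

theorem isAcyclicMatching (hf : IsMatchingRank M f) : IsAcyclicMatching M where
  covBy := by
    rintro ⟨σ, τ⟩ h
    obtain ⟨hsub, hcard⟩ := hf.facet _ h
    dsimp only at hsub hcard
    refine ⟨lt_of_le_of_ne hsub fun h => ?_, fun ρ h1 h2 => ?_⟩
    · have : σ = τ := h
      subst this
      omega
    · have h1' : #σ.1 < #ρ.1 := Finset.card_lt_card h1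
      have h2' : #ρ.1 < #τ.1 := Finset.card_lt_card h2
      omega
  disjoint := by
    rintro ⟨σ, τ⟩ h ⟨σ', τ'⟩ h' hne
    have c1 : #τ.1 = #σ.1 + 1 := (hf.facet _ h).2
    have c2 : #τ'.1 = #σ'.1 + 1 := (hf.facet _ h').2
    have key : ∀ {ρ τ τ' : Simplex K}, ((τ, ρ) ∈ M ∨ (ρ, τ) ∈ M) →
        ((τ', ρ) ∈ M ∨ (ρ, τ') ∈ M) → τ = τ' := fun h h' =>
      hf.morseSet_subsingleton _ (hf.mem_morseSet.mpr h) (hf.mem_morseSet.mpr h')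
    refine ⟨fun e => ?_, fun e => ?_, fun e => ?_, fun e => ?_⟩ <;> dsimp only at e <;> subst e
    · exact hne (by rw [key (Or.inr h) (Or.inr h')])
    · have := key (Or.inr h) (Or.inl h')
      subst this
      omega
    · have := key (Or.inl h) (Or.inr h')
      subst this
      omega
    · exact hne (by rw [key (Or.inl h) (Or.inl h')])
  antisymm := by
    have key : ∀ x y : Simplex K,
        Relation.TransGen (fun x y => x ≤ y ∨ (x, y) ∈ M ∨ (y, x) ∈ M) x y → f x ≤ f y := by
      have step : ∀ x y : Simplex K, x ≤ y ∨ (x, y) ∈ M ∨ (y, x) ∈ M → f x ≤ f y := by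
        rintro x y (h | h)
        · exact hf.mono _ _ h
        · exact ((hf.eq_iff x y).mpr (Or.inr h)).le
      intro x y h
      induction h with
      | single h => exact step _ _ h
      | tail _ h ih => exact ih.trans (step _ _ h)
    exact fun x y h h' => (hf.eq_iff x y).mp (le_antisymm (key x y h) (key y x h'))

theorem mem_simplexSublevel (hf : IsMatchingRank M f) {k : ℕ} {σ : Finset V} :
    σ ∈ (simplexSublevel (fun ρ : Simplex K => (f ρ : ℝ)) k).faces ↔
      ∃ h : σ ∈ K.faces, f ⟨σ, h⟩ ≤ k := by
  constructor
  · rintro ⟨hne, τ, hsub, hle⟩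
    have hσ : σ ∈ K.faces := (K.isRelLowerSet_faces τ.2).2 hsub hne
    exact ⟨hσ, (hf.mono ⟨σ, hσ⟩ τ hsub).trans (Nat.cast_le.mp hle)⟩
  · rintro ⟨h, hle⟩
    exact ⟨(K.isRelLowerSet_faces h).1, ⟨σ, h⟩, Finset.Subset.refl _, Nat.cast_le.mpr hle⟩

theorem simplexSublevel_eq (hf : IsMatchingRank M f) {k : ℕ} {L : PreAbstractSimplicialComplex V}
    (hLK : L.faces ⊆ K.faces) (h : ∀ σ : Simplex K, f σ ≤ k ↔ σ.1 ∈ L.faces) :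
    simplexSublevel (fun ρ => (f ρ : ℝ)) k = L := by
  refine PreAbstractSimplicialComplex.ext (Set.ext fun σ => ?_)
  rw [hf.mem_simplexSublevel]
  exact ⟨fun ⟨hσ, hle⟩ => (h ⟨σ, hσ⟩).mp hle, fun hσ => ⟨hLK hσ, (h ⟨σ, hLK hσ⟩).mpr hσ⟩⟩

theorem simplexSublevel_succ_eq (hf : IsMatchingRank M f) {k : ℕ}
    (h : ∀ σ : Simplex K, f σ ≠ k + 1) :
    simplexSublevel (fun ρ : Simplex K => (f ρ : ℝ)) (k + 1 : ℕ) =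
      simplexSublevel (fun ρ : Simplex K => (f ρ : ℝ)) k := by
  refine PreAbstractSimplicialComplex.ext (Set.ext fun σ => ?_)
  rw [hf.mem_simplexSublevel, hf.mem_simplexSublevel]
  refine exists_congr fun hσ => ?_
  have := h ⟨σ, hσ⟩
  omega

/-- If the fibre over `k + 1` is a matched pair, then passing from the sublevel complex at `k + 1`
to the one at `k` removes that pair. Its smaller member is a free face: a proper coface has rank at
least `k + 1`, so it is the larger member. -/
theorem elementaryCollapse (hf : IsMatchingRank M f) {k : ℕ} {σ τ : Simplex K}
    (hM : (σ, τ) ∈ M) (hk : f σ = k + 1) :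
    ElementaryCollapse (simplexSublevel (fun ρ : Simplex K => (f ρ : ℝ)) (k + 1 : ℕ))
      (simplexSublevel (fun ρ : Simplex K => (f ρ : ℝ)) k) := by
  have hτ : f τ = k + 1 := ((hf.eq_iff σ τ).mpr (Or.inr (Or.inl hM))).symm.trans hk
  obtain ⟨hsub, hcard⟩ := hf.facet _ hM
  dsimp only at hsub hcard
  have fibre : ∀ ρ : Simplex K, f ρ = k + 1 → ρ = σ ∨ ρ = τ := by
    intro ρ hρ
    rcases (hf.eq_iff ρ σ).mp (hρ.trans hk.symm) with h | h | h
    · exact Or.inl h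
    · exact Or.inr (hf.morseSet_subsingleton σ (hf.mem_morseSet.mpr (Or.inl h))
        (hf.mem_morseSet.mpr (Or.inr hM)))
    · exact Or.inr (hf.morseSet_subsingleton σ (hf.mem_morseSet.mpr (Or.inr h))
        (hf.mem_morseSet.mpr (Or.inr hM)))
  refine ⟨σ.1, hf.mem_simplexSublevel.mpr ⟨σ.2, hk.le⟩, τ.1,
    hf.mem_simplexSublevel.mpr ⟨τ.2, hτ.le⟩, ?_, ?_, ?_⟩
  · refine Finset.ssubset_iff_subset_ne.mpr ⟨hsub, fun h => ?_⟩
    rw [h] at hcard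
    omega
  · intro ρ hρ hss
    obtain ⟨hρK, hle⟩ := hf.mem_simplexSublevel.mp hρ
    have hge : f σ ≤ f ⟨ρ, hρK⟩ := hf.mono _ _ hss.subset
    rcases fibre ⟨ρ, hρK⟩ (by omega) with h | h
    · exact absurd (congrArg Subtype.val h).symm hss.ne
    · exact congrArg Subtype.val h
  · ext ρ
    simp only [hf.mem_simplexSublevel, Set.mem_sdiff, Set.mem_insert_iff, Set.mem_singleton_iff,
      not_or]
    constructor
    · rintro ⟨hρ, hle⟩
      refine ⟨⟨hρ, by omega⟩, ?_, ?_⟩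
      · rintro rfl
        have : f σ ≤ k := hle
        omega
      · rintro rfl
        have : f τ ≤ k := hle
        omega
    · rintro ⟨⟨hρ, hle⟩, h1, h2⟩
      refine ⟨hρ, ?_⟩
      by_contra! hlt
      rcases fibre ⟨ρ, hρ⟩ (by omega) with h | h
      · exact h1 (congrArg Subtype.val h)
      · exact h2 (congrArg Subtype.val h)

theorem collapses (hf : IsMatchingRank M f) {k m : ℕ} (hkm : k ≤ m)
    (hM : ∀ σ, k < f σ → f σ ≤ m → ¬ IsCritical (fun ρ => (f ρ : ℝ)) σ) :
    Collapses (simplexSublevel (fun ρ : Simplex K => (f ρ : ℝ)) m)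
      (simplexSublevel (fun ρ : Simplex K => (f ρ : ℝ)) k) := by
  induction m, hkm using Nat.le_induction with
  | base => exact Relation.ReflTransGen.refl
  | succ m hkm ih =>
    have ih' := ih fun σ h h' => hM σ h (by omega)
    by_cases hσ : ∃ σ : Simplex K, f σ = m + 1
    · obtain ⟨σ, hσ⟩ := hσ
      refine Relation.ReflTransGen.head ?_ ih'
      have hc := hM σ (by omega) hσ.le
      simp only [hf.isCritical_iff, not_forall] at hc
      obtain ⟨τ, hτ⟩ := hc
      by_cases h : (τ, σ) ∈ M
      · exact hf.elementaryCollapse h (((hf.eq_iff τ σ).mpr (Or.inr (Or.inl h))).trans hσ)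
      · exact hf.elementaryCollapse (by tauto : (σ, τ) ∈ M) hσ
    · rw [hf.simplexSublevel_succ_eq (not_exists.mp hσ)]
      exact ih'

/-- The fibre of the rank over the rank of a critical simplex is that simplex alone. -/
theorem simplexSublevel_succ_eq_insert (hf : IsMatchingRank M f) {k : ℕ} {σ : Simplex K}
    (hσ : IsCritical (fun ρ => (f ρ : ℝ)) σ) (hk : f σ = k + 1) :
    (simplexSublevel (fun ρ : Simplex K => (f ρ : ℝ)) (k + 1 : ℕ)).faces =
      insert σ.1 (simplexSublevel (fun ρ : Simplex K => (f ρ : ℝ)) k).faces := by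
  ext ρ
  simp only [Set.mem_insert_iff, hf.mem_simplexSublevel]
  constructor
  · rintro ⟨hρ, hle⟩
    rcases Nat.lt_or_ge k (f ⟨ρ, hρ⟩) with h | h
    · rcases (hf.eq_iff ⟨ρ, hρ⟩ σ).mp (by omega) with h | h | h
      · exact Or.inl (congrArg Subtype.val h)
      · exact absurd h ((hf.isCritical_iff σ).mp hσ _).1
      · exact absurd h ((hf.isCritical_iff σ).mp hσ _).2
    · exact Or.inr ⟨hρ, h⟩
  · rintro (rfl | ⟨hρ, hle⟩)
    · exact ⟨σ.2, hk.le⟩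
    · exact ⟨hρ, by omega⟩

end IsMatchingRank

end MatchingRank

/-! ### Ranks and levels -/

/-- The rank of `i` is the number of values of `h` up to `h i`. Every initial segment of the values
is then cut out by a threshold, possibly `0`. -/
theorem exists_nat_rank {ι P : Type*} [Finite ι] [LinearOrder P] (h : ι → P) :
    ∃ f : ι → ℕ, (∀ i j, f i ≤ f j ↔ h i ≤ h j) ∧
      ∃ k : Set P → ℕ, Monotone k ∧ ∀ S, IsLowerSet S → ∀ i, f i ≤ k S ↔ h i ∈ S := by
  have hfin : (Set.range h).Finite := Set.finite_range h
  have hcard : ∀ S : Set P, IsLowerSet S → ∀ i,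
      (Set.range h ∩ Set.Iic (h i)).ncard ≤ (Set.range h ∩ S).ncard ↔ h i ∈ S := by
    intro S hS i
    constructor
    · intro hle
      by_contra hi
      have hlt : ∀ p ∈ S, p < h i := fun p hp => lt_of_not_ge fun hge => hi (hS hge hp)
      refine absurd hle (not_le.mpr (Set.ncard_lt_ncard ?_ (hfin.inter_of_left _)))
      have hsub : Set.range h ∩ S ⊆ Set.range h ∩ Set.Iic (h i) :=
        fun p hp => ⟨hp.1, (hlt p hp.2).le⟩
      exact (Set.ssubset_iff_of_subset hsub).mpr ⟨h i, ⟨⟨i, rfl⟩, le_rfl⟩, fun hp => hi hp.2⟩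
    · intro hi
      exact Set.ncard_le_ncard (fun p hp => ⟨hp.1, hS hp.2 hi⟩) (hfin.inter_of_left _)
  exact ⟨fun i => (Set.range h ∩ Set.Iic (h i)).ncard,
    fun i j => hcard (Set.Iic (h j)) (isLowerSet_Iic _) i,
    fun S => (Set.range h ∩ S).ncard,
    fun _ _ hST => Set.ncard_le_ncard (Set.inter_subset_inter_right _ hST)
      (hfin.inter_of_left _), hcard⟩

theorem level_lt_numLevels {V : Type u} [Fintype V] (g : V → ℝ) (v : V) :
    level g v < numLevels g := by
  refine Finset.card_lt_card ((Finset.ssubset_iff_of_subset (Finset.filter_subset _ _)).mpr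
    ⟨g v, ?_, ?_⟩) <;> simp

/-! ### The matching of a choice of dominating vertices -/

section StrongMatching

variable {V : Type u} {K : AbstractSimplicialComplex V} {g : V → ℝ}

theorem lastVertex_mem (lo : LinearOrder V) (σ : Simplex K) : lastVertex lo σ ∈ σ.1 :=
  @Finset.max'_mem V lo _ _

theorem le_lastVertex (lo : LinearOrder V) (σ : Simplex K) {u : V} (hu : u ∈ σ.1) :
    lo.le u (lastVertex lo σ) :=
  @Finset.le_max' V lo _ _ hu

theorem lastVertex_eq_iff (lo : LinearOrder V) (σ : Simplex K) (v : V) :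
    lastVertex lo σ = v ↔ v ∈ σ.1 ∧ ∀ u ∈ σ.1, lo.le u v := by
  constructor
  · rintro rfl
    exact ⟨lastVertex_mem lo σ, fun u => le_lastVertex lo σ⟩
  · rintro ⟨h1, h2⟩
    exact lo.le_antisymm _ _ (h2 _ (lastVertex_mem lo σ)) (le_lastVertex lo σ h1)

variable {lo : LinearOrder V}

theorem le_of_lo_le (hlo : ∀ v w : V, lo.lt v w → g v ≤ g w) {v w : V} (h : lo.le v w) :
    g v ≤ g w := by
  rcases @lt_or_eq_of_le V lo.toPartialOrder _ _ h with h | rfl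
  · exact hlo _ _ h
  · exact le_rfl

theorem le_lastVertex_value (hlo : ∀ v w : V, lo.lt v w → g v ≤ g w) (σ : Simplex K) {u : V}
    (hu : u ∈ σ.1) : g u ≤ g (lastVertex lo σ) :=
  le_of_lo_le hlo (le_lastVertex lo σ hu)

variable [DecidableEq V]

theorem mem_strongCriticalSimplices {σ : Finset V} :
    σ ∈ strongCriticalSimplices K g ↔
      σ ∈ K.faces ∧ ∃ w ∈ σ, StrongCritical K g w ∧ ∀ u ∈ σ, g u ≤ g w := by
  constructor
  · rintro ⟨w, hw, ⟨hσ, hle⟩, hwσ⟩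
    exact ⟨hσ, w, hwσ, hw, hle⟩
  · rintro ⟨hσ, w, hwσ, hw, hle⟩
    exact ⟨w, hw, ⟨hσ, hle⟩, hwσ⟩

theorem descendingDominated_of_notMem (hlo : ∀ v w : V, lo.lt v w → g v ≤ g w) {σ : Simplex K}
    (hσ : σ.1 ∉ strongCriticalSimplices K g) {v : V} (hv : v ∈ σ.1)
    (hg : g v = g (lastVertex lo σ)) : DescendingDominated K g v := by
  by_contra h
  exact hσ (mem_strongCriticalSimplices.mpr
    ⟨σ.2, v, hv, h, fun u hu => hg ▸ le_lastVertex_value hlo σ hu⟩)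

/-- A simplex contains a strong critical vertex on its highest level as soon as a face reaching the
same level does. -/
theorem mem_strongCriticalSimplices_of_subset (hlo : ∀ v w : V, lo.lt v w → g v ≤ g w)
    {σ τ : Simplex K} (hsub : σ.1 ⊆ τ.1) (hg : g (lastVertex lo σ) = g (lastVertex lo τ))
    (hσ : σ.1 ∈ strongCriticalSimplices K g) : τ.1 ∈ strongCriticalSimplices K g := by
  obtain ⟨-, w, hw, hcrit, hle⟩ := mem_strongCriticalSimplices.mp hσ
  refine mem_strongCriticalSimplices.mpr ⟨τ.2, w, hsub hw, hcrit, fun u hu => ?_⟩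
  exact ((le_lastVertex_value hlo τ hu).trans_eq hg.symm).trans (hle _ (lastVertex_mem lo σ))

variable (c : DominatingChoice K g)

theorem a_lastVertex_lt (hlo : ∀ v w : V, lo.lt v w → g v ≤ g w) {σ : Simplex K}
    (hσ : σ.1 ∉ strongCriticalSimplices K g) :
    g (c.a (lastVertex lo σ)) < g (lastVertex lo σ) :=
  c.lt _ (descendingDominated_of_notMem hlo hσ (lastVertex_mem lo σ) rfl)

theorem insert_a_mem (hlo : ∀ v w : V, lo.lt v w → g v ≤ g w) {σ : Simplex K}
    (hσ : σ.1 ∉ strongCriticalSimplices K g) :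
    insert (c.a (lastVertex lo σ)) σ.1 ∈ K.faces :=
  ((c.dominates _ (descendingDominated_of_notMem hlo hσ (lastVertex_mem lo σ) rfl)).insert_mem
    (σ := σ.1) ⟨σ.2, fun _ hu => le_lastVertex_value hlo σ hu⟩ (lastVertex_mem lo σ)).1

/-- Adding or removing the vertex that dominates the last vertex affects neither the last vertex nor
the vertices on the highest level, since the dominating vertex lies on a lower level. -/
theorem lastVertex_eq_of_insert_eq (hlo : ∀ v w : V, lo.lt v w → g v ≤ g w) {σ τ : Simplex K}
    (hσ : σ.1 ∉ strongCriticalSimplices K g)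
    (h : insert (c.a (lastVertex lo σ)) τ.1 = insert (c.a (lastVertex lo σ)) σ.1) :
    lastVertex lo τ = lastVertex lo σ ∧ τ.1 ∉ strongCriticalSimplices K g := by
  have hlt := a_lastVertex_lt c hlo hσ
  have hne : lastVertex lo σ ≠ c.a (lastVertex lo σ) := fun e => by rw [← e] at hlt; exact hlt.false
  have hmem : ∀ u, u ≠ c.a (lastVertex lo σ) → (u ∈ τ.1 ↔ u ∈ σ.1) := by
    intro u hu
    have := congrArg (u ∈ ·) h
    simpa [hu] using this
  have hlast : lastVertex lo τ = lastVertex lo σ := by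
    rw [lastVertex_eq_iff]
    refine ⟨(hmem _ hne).mpr (lastVertex_mem lo σ), fun u hu => ?_⟩
    by_cases hua : u = c.a (lastVertex lo σ)
    · rw [hua]
      exact (lo.le_total _ _).resolve_right fun hle => hlt.not_ge (le_of_lo_le hlo hle)
    · exact le_lastVertex lo σ ((hmem u hua).mp hu)
  refine ⟨hlast, fun hτ => hσ ?_⟩
  obtain ⟨-, w, hw, hcrit, hle⟩ := mem_strongCriticalSimplices.mp hτ
  have hgw : g (lastVertex lo σ) ≤ g w := hle _ (hlast ▸ lastVertex_mem lo τ)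
  refine mem_strongCriticalSimplices.mpr ⟨σ.2, w, (hmem w ?_).mp hw, hcrit, fun u hu =>
    (le_lastVertex_value hlo σ hu).trans hgw⟩
  rintro rfl
  exact hlt.not_ge hgw

open Classical in
/-- The larger member of the pair of `σ`; a simplex of a descending open star of a strong critical
vertex is unpaired and its own closure. -/
noncomputable def pairClosure (lo : LinearOrder V) (σ : Simplex K) : Finset V :=
  if σ.1 ∈ strongCriticalSimplices K g then σ.1 else insert (c.a (lastVertex lo σ)) σ.1

theorem pairClosure_of_notMem {σ : Simplex K} (hσ : σ.1 ∉ strongCriticalSimplices K g) :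
    pairClosure c lo σ = insert (c.a (lastVertex lo σ)) σ.1 :=
  if_neg hσ

/-- A pair consists of a simplex without the vertex that dominates its last vertex, and of the
simplex obtained by adding that vertex. -/
theorem mem_strongMatching_iff (hlo : ∀ v w : V, lo.lt v w → g v ≤ g w) {σ τ : Simplex K} :
    (σ, τ) ∈ strongMatching c lo ↔ σ.1 ∉ strongCriticalSimplices K g ∧
      c.a (lastVertex lo σ) ∉ σ.1 ∧ τ.1 = insert (c.a (lastVertex lo σ)) σ.1 := by
  constructor
  · rintro ⟨ρ, hρ, h1, h2⟩
    dsimp only at h1 h2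
    obtain ⟨hlast, hσ⟩ := lastVertex_eq_of_insert_eq c hlo (σ := ρ) (τ := σ) hρ (by
      rw [h1]; ext; simp; tauto)
    refine ⟨hσ, ?_, ?_⟩
    · rw [hlast, h1]; simp
    · rw [hlast, h1, h2]; ext; simp; tauto
  · rintro ⟨h1, h2, h3⟩
    exact ⟨σ, h1, (Finset.erase_eq_of_notMem h2).symm, h3⟩

/-- Every simplex outside the descending open stars of the strong critical vertices is paired. -/
theorem exists_mem_strongMatching (hlo : ∀ v w : V, lo.lt v w → g v ≤ g w) {σ : Simplex K}
    (hσ : σ.1 ∉ strongCriticalSimplices K g) :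
    ∃ τ, (τ, σ) ∈ strongMatching c lo ∨ (σ, τ) ∈ strongMatching c lo := by
  have hlt := a_lastVertex_lt c hlo hσ
  by_cases ha : c.a (lastVertex lo σ) ∈ σ.1
  · have hmem : lastVertex lo σ ∈ σ.1.erase (c.a (lastVertex lo σ)) :=
      Finset.mem_erase.mpr ⟨fun e => by rw [← e] at hlt; exact hlt.false, lastVertex_mem lo σ⟩
    exact ⟨⟨σ.1.erase (c.a (lastVertex lo σ)), (K.isRelLowerSet_faces σ.2).2
      (Finset.erase_subset _ _) ⟨_, hmem⟩⟩,
      Or.inl ⟨σ, hσ, rfl, (Finset.insert_eq_self.mpr ha).symm⟩⟩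
  · exact ⟨⟨_, insert_a_mem c hlo hσ⟩, Or.inr ((mem_strongMatching_iff c hlo).mpr ⟨hσ, ha, rfl⟩)⟩

theorem isFacet_of_mem_strongMatching (hlo : ∀ v w : V, lo.lt v w → g v ≤ g w)
    {p : Simplex K × Simplex K} (hp : p ∈ strongMatching c lo) : IsFacet p.1 p.2 := by
  obtain ⟨-, h2, h3⟩ := (mem_strongMatching_iff c hlo (σ := p.1) (τ := p.2)).mp hp
  rw [IsFacet, h3]
  exact ⟨Finset.subset_insert _ _, Finset.card_insert_of_notMem h2⟩

theorem of_mem_strongMatching (hlo : ∀ v w : V, lo.lt v w → g v ≤ g w) {σ τ : Simplex K}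
    (h : (σ, τ) ∈ strongMatching c lo) :
    lastVertex lo τ = lastVertex lo σ ∧ σ.1 ∉ strongCriticalSimplices K g ∧
      τ.1 ∉ strongCriticalSimplices K g ∧ pairClosure c lo σ = pairClosure c lo τ := by
  obtain ⟨h1, h2, h3⟩ := (mem_strongMatching_iff c hlo).mp h
  obtain ⟨hlast, hτ⟩ := lastVertex_eq_of_insert_eq c hlo (τ := τ) h1 (by simp [h3])
  refine ⟨hlast, h1, hτ, ?_⟩
  rw [pairClosure_of_notMem c h1, pairClosure_of_notMem c hτ, hlast, h3]
  simp

/-- The unpaired simplices are those in the descending open stars of the strong critical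
vertices. -/
theorem isCritical_iff_mem_strongCriticalSimplices (hlo : ∀ v w : V, lo.lt v w → g v ≤ g w)
    {f : Simplex K → ℕ} (hf : IsMatchingRank (strongMatching c lo) f) (σ : Simplex K) :
    IsCritical (fun ρ => (f ρ : ℝ)) σ ↔ σ.1 ∈ strongCriticalSimplices K g := by
  rw [hf.isCritical_iff]
  constructor
  · intro h
    by_contra hσ
    obtain ⟨τ, hτ⟩ := exists_mem_strongMatching c hlo hσ
    exact hτ.elim (h τ).1 (h τ).2
  · intro hσ τ
    exact ⟨fun h => (of_mem_strongMatching c hlo h).2.2.1 hσ,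
      fun h => (of_mem_strongMatching c hlo h).2.1 hσ⟩

variable [Fintype V]

open Classical in
/-- The position of `σ` in the construction of the core: `2 * n` if the highest level of `σ` is `n`
and `σ` is removed by the strong collapse on that level, `2 * n + 1` if it is attached there. -/
noncomputable def stageIndex (g : V → ℝ) (lo : LinearOrder V) (σ : Simplex K) : ℕ :=
  2 * level g (lastVertex lo σ) + if σ.1 ∈ strongCriticalSimplices K g then 1 else 0

theorem level_le_level {u v : V} (h : g u ≤ g v) : level g u ≤ level g v :=
  not_lt.mp fun h' => h.not_gt ((level_lt_iff g v u).mp h')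

theorem stageIndex_mono (hlo : ∀ v w : V, lo.lt v w → g v ≤ g w) {σ τ : Simplex K}
    (h : σ.1 ⊆ τ.1) : stageIndex g lo σ ≤ stageIndex g lo τ := by
  have hg := le_lastVertex_value hlo τ (h (lastVertex_mem lo σ))
  have hl := level_le_level hg
  unfold stageIndex
  rcases hg.lt_or_eq with hlt | heq
  · have := (level_lt_iff g _ _).mpr hlt
    split_ifs <;> omega
  · have := mem_strongCriticalSimplices_of_subset hlo h heq
    split_ifs <;> first | omega | tauto

theorem mem_iff_of_stageIndex_eq {σ τ : Simplex K} (h : stageIndex g lo σ = stageIndex g lo τ) :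
    σ.1 ∈ strongCriticalSimplices K g ↔ τ.1 ∈ strongCriticalSimplices K g := by
  unfold stageIndex at h
  split_ifs at h <;> first | omega | tauto

/-- Among the simplices at the same position, the pairs are ordered colexicographically by their
larger members; as the last vertices count first there, faces come before cofaces even though the
dominating vertices that are added to them are unrelated. -/
theorem pairClosure_colex_mono (hlo : ∀ v w : V, lo.lt v w → g v ≤ g w) {σ τ : Simplex K}
    (h : σ.1 ⊆ τ.1) (hidx : stageIndex g lo σ = stageIndex g lo τ) :
    toColex (pairClosure c lo σ) ≤ toColex (pairClosure c lo τ) := by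
  by_cases hσ : σ.1 ∈ strongCriticalSimplices K g
  · have hτ := (mem_iff_of_stageIndex_eq hidx).mp hσ
    rw [pairClosure, pairClosure, if_pos hσ, if_pos hτ]
    exact Finset.Colex.toColex_mono h
  · have hτ := fun h' => hσ ((mem_iff_of_stageIndex_eq hidx).mpr h')
    rw [pairClosure_of_notMem c hσ, pairClosure_of_notMem c hτ]
    by_cases hlast : lastVertex lo σ = lastVertex lo τ
    · rw [hlast]
      exact Finset.Colex.toColex_mono (Finset.insert_subset_insert _ h)
    · have hle : lastVertex lo σ ≤ lastVertex lo τ := le_lastVertex lo τ (h (lastVertex_mem lo σ))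
      have hub : ∀ u ∈ insert (c.a (lastVertex lo σ)) σ.1, u ≤ lastVertex lo σ := by
        intro u hu
        rcases Finset.mem_insert.mp hu with rfl | hu
        · exact le_of_not_ge fun hge => (a_lastVertex_lt c hlo hσ).not_ge (le_of_lo_le hlo hge)
        · exact le_lastVertex lo σ hu
      refine Finset.Colex.toColex_le_toColex.mpr fun u hu _ => ⟨lastVertex lo τ,
        Finset.mem_insert_of_mem (lastVertex_mem lo τ), fun hmem => ?_, (hub u hu).trans hle⟩
      exact hlast (le_antisymm hle (hub _ hmem))

/-- Simplices with the same position and the same larger member of their pair are equal or paired: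
the last vertex of the larger member, hence the dominating vertex, is common to both. -/
theorem eq_or_mem_strongMatching (hlo : ∀ v w : V, lo.lt v w → g v ≤ g w) {σ τ : Simplex K}
    (hidx : stageIndex g lo σ = stageIndex g lo τ)
    (h : pairClosure c lo σ = pairClosure c lo τ) :
    σ = τ ∨ (σ, τ) ∈ strongMatching c lo ∨ (τ, σ) ∈ strongMatching c lo := by
  by_cases hσ : σ.1 ∈ strongCriticalSimplices K g
  · have hτ := (mem_iff_of_stageIndex_eq hidx).mp hσ
    rw [pairClosure, pairClosure, if_pos hσ, if_pos hτ] at h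
    exact Or.inl (Subtype.ext h)
  · have hτ := fun h' => hσ ((mem_iff_of_stageIndex_eq hidx).mpr h')
    rw [pairClosure_of_notMem c hσ, pairClosure_of_notMem c hτ] at h
    have hlast : ∀ ρ : Simplex K, ∀ hρ : ρ.1 ∉ strongCriticalSimplices K g,
        lastVertex lo (⟨_, insert_a_mem c hlo hρ⟩ : Simplex K) = lastVertex lo ρ := fun ρ hρ =>
      (lastVertex_eq_of_insert_eq c hlo hρ (by simp)).1
    have heq : lastVertex lo σ = lastVertex lo τ := by
      rw [← hlast σ hσ, ← hlast τ hτ]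
      congr 1
      exact Subtype.ext h
    by_cases ha : c.a (lastVertex lo σ) ∈ σ.1 <;> by_cases hb : c.a (lastVertex lo τ) ∈ τ.1
    · rw [Finset.insert_eq_self.mpr ha, Finset.insert_eq_self.mpr hb] at h
      exact Or.inl (Subtype.ext h)
    · rw [Finset.insert_eq_self.mpr ha] at h
      exact Or.inr (Or.inr ((mem_strongMatching_iff c hlo).mpr ⟨hτ, hb, h⟩))
    · rw [Finset.insert_eq_self.mpr hb] at h
      exact Or.inr (Or.inl ((mem_strongMatching_iff c hlo).mpr ⟨hσ, ha, h.symm⟩))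
    · refine Or.inl (Subtype.ext ?_)
      rw [← Finset.erase_insert ha, ← Finset.erase_insert hb, h, heq]

theorem stageIndex_lt_iff_below (hlo : ∀ v w : V, lo.lt v w → g v ≤ g w) (σ : Simplex K) (n : ℕ) :
    stageIndex g lo σ < 2 * n ↔ σ.1 ∈ (below K g n).faces := by
  have h1 : stageIndex g lo σ < 2 * n ↔ level g (lastVertex lo σ) < n := by
    unfold stageIndex
    split_ifs <;> omega
  rw [h1]
  exact ⟨fun h => ⟨σ.2, fun u hu => (level_le_level (le_lastVertex_value hlo σ hu)).trans_lt h⟩,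
    fun h => h.2 _ (lastVertex_mem lo σ)⟩

theorem stageIndex_lt_iff_belowDominated (hlo : ∀ v w : V, lo.lt v w → g v ≤ g w) (σ : Simplex K)
    (n : ℕ) : stageIndex g lo σ < 2 * n + 1 ↔ σ.1 ∈ (belowDominated K g n).faces := by
  have hle : ∀ u ∈ σ.1, level g u ≤ level g (lastVertex lo σ) := fun u hu =>
    level_le_level (le_lastVertex_value hlo σ hu)
  have hval : ∀ u v, level g u = level g v → g u = g v := fun u v h => le_antisymm
    (not_lt.mp fun h' => ((level_lt_iff g _ _).mpr h').ne' h)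
    (not_lt.mp fun h' => ((level_lt_iff g _ _).mpr h').ne h)
  constructor
  · intro h
    refine ⟨σ.2, fun u hu => ?_⟩
    have hu' := hle u hu
    rw [Set.mem_ofPred_eq]
    by_cases hlt : level g u < n
    · exact Or.inl hlt
    · have hcrit : σ.1 ∉ strongCriticalSimplices K g := by
        intro hσ
        rw [stageIndex, if_pos hσ] at h
        omega
      rw [stageIndex, if_neg hcrit] at h
      exact Or.inr ⟨by omega, descendingDominated_of_notMem hlo hcrit hu (hval _ _ (by omega))⟩
  · intro h
    have hlast := h.2 _ (lastVertex_mem lo σ)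
    rw [Set.mem_ofPred_eq] at hlast
    unfold stageIndex
    split_ifs with hσ
    · obtain ⟨-, w, hw, hcrit, hmax⟩ := mem_strongCriticalSimplices.mp hσ
      have hw' := h.2 w hw
      rw [Set.mem_ofPred_eq] at hw'
      have hge := level_le_level (hmax _ (lastVertex_mem lo σ))
      rcases hw' with hw' | hw'
      · omega
      · exact absurd hw'.2 hcrit
    · omega

/-- The rank underlying the discrete Morse function: simplices are ordered by their position in the
construction of the core and then by the larger members of their pairs. The complexes of that
construction are sublevel complexes of the rank. -/
theorem exists_strongMatching_rank (hlo : ∀ v w : V, lo.lt v w → g v ≤ g w) :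
    ∃ f : Simplex K → ℕ, IsMatchingRank (strongMatching c lo) f ∧
      ∃ k : ℕ → ℕ, Monotone k ∧ ∀ N σ, f σ ≤ k N ↔ stageIndex g lo σ < N := by
  let key : Simplex K → ℕ ×ₗ Colex (Finset V) := fun σ =>
    toLex (stageIndex g lo σ, toColex (pairClosure c lo σ))
  obtain ⟨f, hf, k, hmono, hk⟩ := exists_nat_rank key
  have heq : ∀ σ τ, f σ = f τ ↔ key σ = key τ := fun σ τ => by
    rw [le_antisymm_iff, hf, hf, ← le_antisymm_iff]
  have hkey : ∀ σ τ, key σ = key τ ↔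
      stageIndex g lo σ = stageIndex g lo τ ∧ pairClosure c lo σ = pairClosure c lo τ := by
    intro σ τ
    simp [key]
  refine ⟨f, ⟨fun p hp => isFacet_of_mem_strongMatching c hlo hp, fun σ τ h => ?_,
    fun σ τ => ?_⟩, fun N => k {p | (ofLex p).1 < N},
    fun _ _ h => hmono fun _ hp => lt_of_lt_of_le hp h, fun N => hk _ fun p q hqp hp =>
      (Prod.Lex.monotone_fst _ _ hqp).trans_lt hp⟩
  · rw [hf, Prod.Lex.toLex_le_toLex']
    exact ⟨stageIndex_mono hlo h, pairClosure_colex_mono c hlo h⟩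
  · rw [heq, hkey]
    have hpair : ∀ {σ τ : Simplex K}, (σ, τ) ∈ strongMatching c lo →
        stageIndex g lo σ = stageIndex g lo τ ∧ pairClosure c lo σ = pairClosure c lo τ := by
      intro σ τ h
      obtain ⟨h1, h2, h3, h4⟩ := of_mem_strongMatching c hlo h
      exact ⟨by rw [stageIndex, stageIndex, if_neg h2, if_neg h3, h1], h4⟩
    constructor
    · exact fun h => eq_or_mem_strongMatching c hlo h.1 h.2
    · rintro (rfl | h | h)
      · exact ⟨rfl, rfl⟩
      · exact hpair h
      · exact ⟨(hpair h).1.symm, (hpair h).2.symm⟩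

end StrongMatching

/-! ### Adjunction spaces as pushouts -/

section Pushout

variable {A B X : Type u} [TopologicalSpace A] [TopologicalSpace B] [TopologicalSpace X]

/-- The canonical map `X → X ∪_φ B`. -/
def Glue.inl (i : C(A, B)) (φ : C(A, X)) : C(X, Glue i φ) where
  toFun x := Quot.mk _ (Sum.inl x)
  continuous_toFun := continuous_quot_mk.comp continuous_inl

theorem Glue.condition (i : C(A, B)) (φ : C(A, X)) :
    (Glue.inr i φ).comp i = (Glue.inl i φ).comp φ :=
  ContinuousMap.ext fun a => Quot.sound (GlueRel.glue a)

/-- The map out of an adjunction space given by compatible maps on its two parts. -/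
def Glue.desc {i : C(A, B)} {φ : C(A, X)} {Z : Type u} [TopologicalSpace Z] (p : C(B, Z))
    (q : C(X, Z)) (h : p.comp i = q.comp φ) : C(Glue i φ, Z) where
  toFun := Quot.lift (Sum.elim q p) (by rintro _ _ ⟨a⟩; exact DFunLike.congr_fun h a)
  continuous_toFun := continuous_quot_lift _ (q.continuous.sumElim p.continuous)

theorem Glue.isPushout (i : C(A, B)) (φ : C(A, X)) :
    IsPushout (TopCat.ofHom i) (TopCat.ofHom φ) (TopCat.ofHom (Glue.inr i φ))
      (TopCat.ofHom (Glue.inl i φ)) where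
  w := by
    rw [← TopCat.ofHom_comp, ← TopCat.ofHom_comp, Glue.condition]
  isColimit' := by
    refine ⟨PushoutCocone.isColimitAux' _ fun s => ?_⟩
    have hs : s.inl.hom.comp i = s.inr.hom.comp φ := by
      have := congrArg TopCat.Hom.hom s.condition
      simpa using this
    refine ⟨TopCat.ofHom (Glue.desc s.inl.hom s.inr.hom hs), ?_, ?_, ?_⟩
    · rfl
    · rfl
    · intro m h1 h2
      ext x
      induction x using Quot.ind with
      | mk x =>
        rcases x with x | b
        · exact ConcreteCategory.congr_hom h2 x
        · exact ConcreteCategory.congr_hom h1 b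

end Pushout

/-! ### Stages of the internal core -/

section Stages

variable {V : Type u} [DecidableEq V] [Fintype V] {K : AbstractSimplicialComplex V}

/-- Up to homeomorphism, the space `Y` with the map `S : |L| → Y` is a stage of an internal core of
`f`, and `L` is the sublevel complex at `α`. -/
def IsStageModel (f : Simplex K → ℝ) (α : ℝ) (L : PreAbstractSimplicialComplex V) (Y : TopCat.{u})
    (S : C(realization L, Y)) : Prop :=
  simplexSublevel f α = L ∧
    ∃ (X : TopCat.{u}) (R : C(realization (simplexSublevel f α), X)),
      InternalCoreStage f α X R ∧ ∃ e : Y ≃ₜ X, ∀ x hx hx', e (S ⟨x, hx⟩) = R ⟨x, hx'⟩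

variable {f : Simplex K → ℝ} {α β : ℝ} {L L' : PreAbstractSimplicialComplex V} {Y : TopCat.{u}}
  {S : C(realization L, Y)}

theorem IsStageModel.start (hL : simplexSublevel f α = L) (hα : ∀ σ, α < f σ) :
    IsStageModel f α L (TopCat.of (realization L)) (ContinuousMap.id _) := by
  subst hL
  exact ⟨rfl, _, _, InternalCoreStage.start α hα, Homeomorph.refl _, fun _ _ _ => rfl⟩

theorem IsStageModel.collapse (h : IsStageModel f α L Y S) (hL' : simplexSublevel f β = L')
    (hαβ : α ≤ β) (hcrit : ∀ σ, IsCritical f σ → ¬ (α < f σ ∧ f σ ≤ β)) (hcoll : Collapses L' L)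
    (hLL' : L.faces ⊆ L'.faces) {ρ : C(realization L', realization L)}
    (hρ : IsStrongDeformationRetraction hLL' ρ) : IsStageModel f β L' Y (S.comp ρ) := by
  obtain ⟨rfl, X, R, hR, e, he⟩ := h
  subst hL'
  exact ⟨rfl, X, _, InternalCoreStage.collapse hαβ hR hcrit hcoll ρ hρ, e,
    fun x hx _ => he _ _ _⟩

/-- Raising the level without meeting a simplex is a trivial internal collapse. -/
theorem IsStageModel.of_le (h : IsStageModel f α L Y S) (hαβ : α ≤ β)
    (hL : simplexSublevel f β = L) (hcrit : ∀ σ, ¬ (α < f σ ∧ f σ ≤ β)) :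
    IsStageModel f β L Y S :=
  h.collapse hL hαβ (fun σ _ => hcrit σ) Relation.ReflTransGen.refl subset_rfl
    (ρ := ContinuousMap.id _) (ContinuousMap.HomotopicRel.refl _)

/-- Attaching a critical simplex produces a model of any pushout. -/
theorem IsStageModel.attach (h : IsStageModel f α L Y S) (hL' : simplexSublevel f β = L')
    (hαβ : α ≤ β) {σ : Simplex K} (hσ : IsCritical f σ) (hσL : σ.1 ∉ L.faces)
    (hins : L'.faces = insert σ.1 L.faces) (hLL' : L.faces ⊆ L'.faces) {Y' : TopCat.{u}}
    {S' : C(realization L', Y')} {j : Y ⟶ Y'}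
    (hp : IsPushout (TopCat.ofHom (realizationIncl hLL')) (TopCat.ofHom S) (TopCat.ofHom S') j) :
    IsStageModel f β L' Y' S' := by
  obtain ⟨rfl, X, R, hR, e, he⟩ := h
  subst hL'
  have hq := Glue.isPushout (realizationIncl hLL') R
  have hS : TopCat.ofHom R = TopCat.ofHom S ≫ (TopCat.isoOfHomeo e).hom := by
    ext x
    exact (he x.1 x.2 x.2).symm
  have hp' : IsPushout (TopCat.ofHom (realizationIncl hLL')) (TopCat.ofHom R) (TopCat.ofHom S')
      ((TopCat.isoOfHomeo e).inv ≫ j) :=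
    hp.of_iso (Iso.refl _) (Iso.refl _) (TopCat.isoOfHomeo e) (Iso.refl _)
      (by simp) (by simp [hS]) (by simp)
      (by rw [Iso.hom_inv_id_assoc, Iso.refl_hom, Category.comp_id])
  refine ⟨rfl, _, _, InternalCoreStage.attach hαβ hR σ hσ hσL hins,
    TopCat.homeoOfIso (hp'.isoIsPushout _ _ hq), fun x hx hx' => ?_⟩
  exact ConcreteCategory.congr_hom (hp'.inl_isoIsPushout_hom _ _ hq) ⟨x, hx⟩

theorem IsStageModel.congr {Y' : TopCat.{u}} {S' : C(realization L, Y')}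
    (h : IsStageModel f α L Y S) (e : Y' ≃ₜ Y) (he : ∀ x, e (S' x) = S x) :
    IsStageModel f α L Y' S' := by
  obtain ⟨hL, X, R, hR, e', he'⟩ := h
  exact ⟨hL, X, R, hR, e.trans e', fun x hx hx' => by
    rw [← he' x hx hx', ← he]; rfl⟩

/-- Attaching critical simplices one at a time produces a model of the adjunction space in which all
of them are attached at once, since pushout squares can be pasted. -/
theorem IsMatchingRank.isStageModel_glue {M : Set (Simplex K × Simplex K)} {f : Simplex K → ℕ}
    (hf : IsMatchingRank M f) {k : ℕ} (h : IsStageModel (fun ρ => (f ρ : ℝ)) k L Y S) {m : ℕ}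
    (hkm : k ≤ m) (hcrit : ∀ σ, k < f σ → f σ ≤ m → IsCritical (fun ρ => (f ρ : ℝ)) σ)
    (hL' : simplexSublevel (fun ρ => (f ρ : ℝ)) m = L') (hLL' : L.faces ⊆ L'.faces) :
    IsStageModel (fun ρ => (f ρ : ℝ)) m L' (TopCat.of (Glue (realizationIncl hLL') S))
      (Glue.inr (realizationIncl hLL') S) := by
  induction m, hkm using Nat.le_induction generalizing L' with
  | base =>
    obtain rfl : L = L' := h.1.symm.trans hL'
    have hid : TopCat.ofHom (realizationIncl hLL') = 𝟙 (TopCat.of (realization L)) := rfl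
    have hp := Glue.isPushout (realizationIncl hLL') S
    have hq : IsPushout (TopCat.ofHom (realizationIncl hLL')) (TopCat.ofHom S) (TopCat.ofHom S)
        (𝟙 Y) := hid ▸ IsPushout.of_id_fst
    refine h.congr (TopCat.homeoOfIso (hp.isoIsPushout _ _ hq)) fun x => ?_
    exact ConcreteCategory.congr_hom (hp.inl_isoIsPushout_hom _ _ hq) x
  | succ m hkm ih =>
    have ih' := fun (L'' : PreAbstractSimplicialComplex V) hL'' =>
      ih (L' := L'') (fun σ h h' => hcrit σ h (by omega)) hL''
    have hcast : ((m : ℕ) : ℝ) ≤ ((m + 1 : ℕ) : ℝ) := by simp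
    by_cases hσ : ∃ σ : Simplex K, f σ = m + 1
    · obtain ⟨σ, hσ⟩ := hσ
      have hc := hcrit σ (by omega) hσ.le
      have hsub : L.faces ⊆ (simplexSublevel (fun ρ : Simplex K => (f ρ : ℝ)) m).faces := by
        rw [← h.1]
        exact simplexSublevel_mono _ (Nat.cast_le.mpr hkm)
      have hsub' : (simplexSublevel (fun ρ : Simplex K => (f ρ : ℝ)) m).faces ⊆ L'.faces := by
        rw [← hL']
        exact simplexSublevel_mono _ hcast
      have hp₁ := Glue.isPushout (realizationIncl hsub) S
      have hp₂ := Glue.isPushout (realizationIncl hLL') S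
      let d : C(Glue (realizationIncl hsub) S, Glue (realizationIncl hLL') S) :=
        Glue.desc ((Glue.inr (realizationIncl hLL') S).comp (realizationIncl hsub'))
          (Glue.inl (realizationIncl hLL') S) (Glue.condition (realizationIncl hLL') S)
      have hp : IsPushout (TopCat.ofHom (realizationIncl hsub'))
          (TopCat.ofHom (Glue.inr (realizationIncl hsub) S))
          (TopCat.ofHom (Glue.inr (realizationIncl hLL') S)) (TopCat.ofHom d) := by
        refine (IsPushout.paste_horiz_iff hp₁ ?_).mp hp₂
        rfl
      refine (ih' _ rfl hsub).attach hL' hcast hc ?_ ?_ hsub' hp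
      · rw [hf.mem_simplexSublevel]
        rintro ⟨_, hle⟩
        have : f σ ≤ m := hle
        omega
      · rw [← hL', hf.simplexSublevel_succ_eq_insert hc hσ]
    · have heq := hf.simplexSublevel_succ_eq (not_exists.mp hσ)
      refine (ih' L' (heq.symm.trans hL') hLL').of_le hcast hL' fun σ hlt => ?_
      have h1 : m < f σ := Nat.cast_lt.mp hlt.1
      have h2 : f σ ≤ m + 1 := Nat.cast_le.mp hlt.2
      exact hσ ⟨σ, by omega⟩

end Stages

/-! ### The retraction of a strong collapse -/

section Retraction

variable {V : Type u} [Fintype V]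

theorem mem_carrier {x : V → ℝ} {v : V} : v ∈ carrier x ↔ x v ≠ 0 := by
  simp [carrier]

variable [DecidableEq V] {K : AbstractSimplicialComplex V} {g : V → ℝ} (c : DominatingChoice K g)

theorem below_subset_belowDominated (K : AbstractSimplicialComplex V) (g : V → ℝ) (n : ℕ) :
    (below K g n).faces ⊆ (belowDominated K g n).faces :=
  fun _ hσ => ⟨hσ.1, fun u hu => Or.inl (hσ.2 u hu)⟩

/-- The retraction of the strong collapse is contiguous to the identity: the vertices dominating
the vertices of `σ` on the highest level may be added to `σ` one at a time. -/
theorem union_image_retractVertex_mem {n : ℕ} {σ : Finset V}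
    (hσ : σ ∈ (belowDominated K g n).faces) :
    σ ∪ σ.image (retractVertex c n) ∈ (belowDominated K g n).faces := by
  classical
  have hbelow := (retractVertex_simplicial c n σ hσ).2
  refine ⟨?_, fun u hu => (Finset.mem_union.mp hu).elim (hσ.2 u) fun hu => Or.inl (hbelow u hu)⟩
  have key : ∀ T ⊆ σ, σ ∪ T.image (retractVertex c n) ∈ K.faces := by
    intro T
    induction T using Finset.induction_on with
    | empty => intro _; simpa using hσ.1
    | insert v T _ ih =>
      intro hT
      have ih' := ih ((Finset.subset_insert _ _).trans hT)
      have hv : v ∈ σ := hT (Finset.mem_insert_self _ _)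
      rw [Finset.image_insert, Finset.union_insert]
      by_cases h : level g v = n ∧ DescendingDominated K g v
      · rw [retractVertex, if_pos h]
        refine ((c.dominates v h.2).insert_mem (σ := σ ∪ T.image (retractVertex c n))
          ⟨ih', fun u hu => ?_⟩ (Finset.mem_union_left _ hv)).1
        change g u ≤ g v
        refine not_lt.mp fun hlt => ?_
        have hlev := (level_lt_iff g v u).mpr hlt
        rcases Finset.mem_union.mp hu with hu | hu
        · have := hσ.2 u hu
          rw [Set.mem_ofPred_eq] at this
          omega
        · have := hbelow u (Finset.image_subset_image
            ((Finset.subset_insert _ _).trans hT) hu)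
          rw [Set.mem_ofPred_eq] at this
          omega
      · rw [retractVertex, if_neg h, Finset.insert_eq_self.mpr (Finset.mem_union_left _ hv)]
        exact ih'
  exact key σ (Finset.Subset.refl σ)

theorem strongRetraction_apply_of_mem_below {n : ℕ} (x : realization (belowDominated K g n))
    (hx : carrier x.1 ∈ (below K g n).faces) : (strongRetraction c n x).1 = x.1 := by
  funext u
  change ∑ v with retractVertex c n v = u, x.1 v = x.1 u
  have hfix : ∀ v, x.1 v ≠ 0 → retractVertex c n v = v := by
    intro v hv
    have hlt : level g v < n := hx.2 v (mem_carrier.mpr hv)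
    exact if_neg fun h => hlt.ne h.1
  rw [Finset.sum_filter]
  have : ∀ v ∈ univ, (if retractVertex c n v = u then x.1 v else 0) =
      if v = u then x.1 v else 0 := by
    intro v _
    by_cases hv : x.1 v = 0
    · simp [hv]
    · rw [hfix v hv]
  rw [Finset.sum_congr rfl this]
  simp

/-- The straight-line homotopy from the identity to the retraction stays inside the realization,
as a point and its image lie in a common simplex. -/
theorem isStrongDeformationRetraction_strongRetraction (n : ℕ) :
    IsStrongDeformationRetraction (below_subset_belowDominated K g n) (strongRetraction c n) := by
  have hmem : ∀ (t : unitInterval) (x : realization (belowDominated K g n)),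
      (fun v => (1 - (t : ℝ)) * x.1 v + t * (strongRetraction c n x).1 v) ∈
        realization (belowDominated K g n) := by
    intro t x
    have ht0 : (0 : ℝ) ≤ t := t.2.1
    have ht1 : (0 : ℝ) ≤ 1 - t := sub_nonneg.mpr t.2.2
    obtain ⟨y0, y1, -⟩ := (strongRetraction c n x).2
    obtain ⟨x0, x1, xc⟩ := x.2
    have hsum : ∑ v, ((1 - (t : ℝ)) * x.1 v + t * (strongRetraction c n x).1 v) = 1 := by
      rw [Finset.sum_add_distrib, ← Finset.mul_sum, ← Finset.mul_sum, x1, y1]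
      ring
    refine ⟨fun v => add_nonneg (mul_nonneg ht1 (x0 v)) (mul_nonneg ht0 (y0 v)), hsum, ?_⟩
    refine ((belowDominated K g n).isRelLowerSet_faces (union_image_retractVertex_mem c xc)).2
      (fun v hv => ?_) ?_
    · rw [mem_carrier] at hv
      by_contra hv'
      rw [Finset.mem_union, not_or, mem_carrier, not_not] at hv'
      refine hv ?_
      have hy : (strongRetraction c n x).1 v = 0 := by
        refine Finset.sum_eq_zero fun u hu => ?_
        by_contra hne
        exact hv'.2 (Finset.mem_image.mpr
          ⟨u, mem_carrier.mpr hne, (Finset.mem_filter.mp hu).2⟩)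
      rw [hv'.1, hy]
      ring
    · rw [Finset.nonempty_iff_ne_empty]
      intro he
      refine zero_ne_one (α := ℝ) ?_
      rw [← hsum]
      refine (Finset.sum_eq_zero fun v _ => ?_).symm
      by_contra hne
      exact Finset.notMem_empty v (he ▸ mem_carrier.mpr hne)
  refine ⟨⟨⟨⟨fun p => ⟨_, hmem p.1 p.2⟩, ?_⟩, fun x => ?_, fun x => ?_⟩, fun t x hx => ?_⟩⟩
  · have := (strongRetraction c n).continuous
    refine Continuous.subtype_mk (continuous_pi fun v => ?_) _
    have h1 : Continuous fun p : unitInterval × realization (belowDominated K g n) =>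
        (strongRetraction c n p.2).1 v :=
      (continuous_apply v).comp (continuous_subtype_val.comp (this.comp continuous_snd))
    have h2 : Continuous fun p : unitInterval × realization (belowDominated K g n) => p.2.1 v :=
      (continuous_apply v).comp (continuous_subtype_val.comp continuous_snd)
    fun_prop
  · refine Subtype.ext (funext fun v => ?_)
    simp
  · refine Subtype.ext (funext fun v => ?_)
    simp [realizationIncl]
    rfl
  · obtain ⟨y, rfl⟩ := hx
    refine Subtype.ext (funext fun v => ?_)
    have h := strongRetraction_apply_of_mem_below c
      (realizationIncl (below_subset_belowDominated K g n) y) y.2.2.2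
    simp only [ContinuousMap.coe_mk, ContinuousMap.id_apply, h]
    ring

end Retraction

/-! ### The strong core as an internal core -/

section Comparison

variable {V : Type u} [DecidableEq V] [Fintype V] {K : AbstractSimplicialComplex V} {g : V → ℝ}
  (c : DominatingChoice K g) {lo : LinearOrder V}

/-- Every level contributes one internal collapse, along the retraction of the strong collapse, and
then the attachment of the critical simplices. -/
theorem isStageModel_strongCoreStage (hlo : ∀ v w : V, lo.lt v w → g v ≤ g w)
    {f : Simplex K → ℕ} (hf : IsMatchingRank (strongMatching c lo) f) {k : ℕ → ℕ}
    (hmono : Monotone k) (hk : ∀ N σ, f σ ≤ k N ↔ stageIndex g lo σ < N) (n : ℕ) :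
    IsStageModel (fun ρ => (f ρ : ℝ)) (k (2 * n)) (below K g n) (strongCoreStage c n).1
      (strongCoreStage c n).2 := by
  have hcrit : ∀ σ : Simplex K, IsCritical (fun ρ => (f ρ : ℝ)) σ ↔ Odd (stageIndex g lo σ) := by
    intro σ
    rw [isCritical_iff_mem_strongCriticalSimplices c hlo hf, Nat.odd_iff, stageIndex]
    split_ifs with h <;> simp only [h, true_iff, false_iff] <;> omega
  have hbelow : ∀ n, simplexSublevel (fun ρ => (f ρ : ℝ)) (k (2 * n)) = below K g n := fun n =>
    hf.simplexSublevel_eq (fun _ h => h.1) fun σ =>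
      (hk _ σ).trans (stageIndex_lt_iff_below hlo σ n)
  have hdom : ∀ n, simplexSublevel (fun ρ => (f ρ : ℝ)) (k (2 * n + 1)) = belowDominated K g n :=
    fun n => hf.simplexSublevel_eq (fun _ h => h.1) fun σ =>
      (hk _ σ).trans (stageIndex_lt_iff_belowDominated hlo σ n)
  induction n with
  | zero =>
    refine IsStageModel.start (hbelow 0) fun σ => Nat.cast_lt.mpr (not_le.mp fun h => ?_)
    exact absurd ((hk _ σ).mp h) (by simp)
  | succ n ih =>
    have hle : ∀ {a b : ℕ}, a ≤ b → (k a : ℝ) ≤ k b := fun h => Nat.cast_le.mpr (hmono h)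
    have hcoll : IsStageModel (fun ρ => (f ρ : ℝ)) (k (2 * n + 1)) (belowDominated K g n)
        (strongCoreStage c n).1 ((strongCoreStage c n).2.comp (strongRetraction c n)) := by
      refine ih.collapse (hdom n) (hle (by omega)) (fun σ hσ h => ?_) ?_
        (below_subset_belowDominated K g n) (isStrongDeformationRetraction_strongRetraction c n)
      · have h1 := (hk _ σ).not.mp (Nat.cast_lt.mp h.1).not_ge
        have h2 := (hk _ σ).mp (Nat.cast_le.mp h.2)
        have := Nat.odd_iff.mp ((hcrit σ).mp hσ)
        omega
      · rw [← hdom, ← hbelow]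
        refine hf.collapses (hmono (by omega)) fun σ h1 h2 hσ => ?_
        have h1' := (hk _ σ).not.mp h1.not_ge
        have h2' := (hk _ σ).mp h2
        have := Nat.odd_iff.mp ((hcrit σ).mp hσ)
        omega
    refine hf.isStageModel_glue hcoll (hmono (by omega)) (fun σ h1 h2 => (hcrit σ).mpr ?_)
      (hbelow (n + 1)) (belowDominated_subset K g n)
    have h1' := (hk _ σ).not.mp h1.not_ge
    have h2' := (hk _ σ).mp h2
    rw [Nat.odd_iff]
    omega

end Comparison

end StrongMorse

theorem mainTheorem5 {V : Type*} [Fintype V] [DecidableEq V] (K : AbstractSimplicialComplex V)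
    (g : V → ℝ) (c : StrongMorse.DominatingChoice K g) (lo : LinearOrder V)
    (hlo : ∀ v w : V, lo.lt v w → g v ≤ g w) :
    StrongMorse.IsAcyclicMatching (StrongMorse.strongMatching c lo) ∧
    ∃ f : StrongMorse.Simplex K → ℝ,
      StrongMorse.IsDiscreteMorse f ∧
      (∀ σ, StrongMorse.IsCritical f σ ↔ σ.1 ∈ StrongMorse.strongCriticalSimplices K g) ∧
      StrongMorse.morseMatching f = StrongMorse.strongMatching c lo ∧
      ∃ (α : ℝ) (X : TopCat) (R : C(StrongMorse.realization (StrongMorse.simplexSublevel f α), X)),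
        (∀ σ, f σ ≤ α) ∧ StrongMorse.InternalCoreStage f α X R ∧
        ∃ h : StrongMorse.strongCore c ≃ₜ X, ∀ σ ∈ StrongMorse.strongCriticalSimplices K g,
          h '' StrongMorse.openCell (StrongMorse.strongCoreMap c) σ = StrongMorse.openCell R σ := by
  obtain ⟨f, hf, k, hmono, hk⟩ := StrongMorse.exists_strongMatching_rank c hlo
  have hcrit := StrongMorse.isCritical_iff_mem_strongCriticalSimplices c hlo hf
  refine ⟨hf.isAcyclicMatching, fun σ => (f σ : ℝ), hf.isDiscreteMorse, hcrit,
    hf.morseMatching_eq, ?_⟩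
  obtain ⟨hL, X, R, hR, e, he⟩ :=
    StrongMorse.isStageModel_strongCoreStage c hlo hf hmono hk (StrongMorse.numLevels g)
  refine ⟨_, X, R, fun σ => ?_, hR, e, fun σ _ => ?_⟩
  · rw [Nat.cast_le, hk, StrongMorse.stageIndex_lt_iff_below hlo]
    exact ⟨σ.2, fun u _ => StrongMorse.level_lt_numLevels g u⟩
  · ext y
    constructor
    · rintro ⟨_, ⟨x, hx, rfl⟩, rfl⟩
      exact ⟨⟨x.1, by rw [hL]; exact x.2⟩, hx, (he _ _ _).symm⟩
    · rintro ⟨x, hx, rfl⟩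
      exact ⟨_, ⟨⟨x.1, by rw [← hL]; exact x.2⟩, hx, rfl⟩, he _ _ _⟩
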